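/- Let $(\xi(n))_{n\in\mathbb Z}$ be a (strictly) stationary random process with values in $\mathbb Z$ and with $\mathbb E\,\xi(0)^2<\infty$. Let $\rho$ be its spectral measure, that is, the finite positive Borel measure on the unit circle $\mathbb T$ with $$\operatorname{Cov}(\xi(0),\xi(m))=\mathbb E\bigl[(\xi(0)-\mathbb E\xi(0))\,\overline{(\xi(m)-\mathbb E\xi(m))}\bigr]=\int_{\mathbb T} t^{-m}\,d\rho(t)\qquad (m\in\mathbb Z).$$ If the closed support of $\rho$ is not all of $\mathbb T$, then the process $\xi$ is periodic: there is a (non-random) positive integer $N$ such that, almost surely, $\xi(n+N)=\xi(n)$ for all $n\in\mathbb Z$. -/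

import Mathlib

open MeasureTheory ProbabilityTheory

/-- A random process indexed by `ℤ` is (strictly) stationary if all its time shifts have the same
law on the sequence space. -/
def IsStationaryProcess {Ω S : Type*} [MeasurableSpace Ω] [MeasurableSpace S]
    (P : Measure Ω) (ξ : ℤ → Ω → S) : Prop :=
  ∀ k : ℤ, IdentDistrib (fun ω (n : ℤ) => ξ (n + k) ω) (fun ω (n : ℤ) => ξ n ω) P P

/-- The covariance function `r(m) = Cov(ξ(0), ξ(m))`, i.e. the expectation of `ξ(0) * conj ξ(m)`
after centering. -/
noncomputable def covarianceFunction {Ω : Type*} [MeasurableSpace Ω]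
    (P : Measure Ω) (ξ : ℤ → Ω → ℂ) (m : ℤ) : ℂ :=
  ∫ ω, (ξ 0 ω - ∫ ω', ξ 0 ω' ∂P) * (starRingEnd ℂ) (ξ m ω - ∫ ω', ξ m ω' ∂P) ∂P

/-- The unit circle carries its Borel σ-algebra. -/
noncomputable instance Circle.instMeasurableSpaceBorel : MeasurableSpace Circle := borel Circle

instance Circle.instBorelSpaceBorel : BorelSpace Circle := ⟨rfl⟩

/-- `ρ` is the spectral measure of `ξ`: the finite positive Borel measure on the unit circle whose
Fourier coefficients `∫ t⁻ᵐ dρ(t)` form the covariance function of `ξ`. -/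
structure IsSpectralMeasure {Ω : Type*} [MeasurableSpace Ω]
    (P : Measure Ω) (ξ : ℤ → Ω → ℂ) (ρ : Measure Circle) : Prop where
  isFiniteMeasure : IsFiniteMeasure ρ
  fourier_eq : ∀ m : ℤ, covarianceFunction P ξ m = ∫ t : Circle, ((t ^ (-m) : Circle) : ℂ) ∂ρ

/-- The process `ξ` is periodic: one positive integer is a period of almost every realization. -/
def IsPeriodicProcess {Ω S : Type*} [MeasurableSpace Ω]
    (P : Measure Ω) (ξ : ℤ → Ω → S) : Prop :=
  ∃ N : ℕ, 0 < N ∧ ∀ᵐ ω ∂P, Function.Periodic (fun n : ℤ => ξ n ω) (N : ℤ)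

/-! ### Integer polynomials that are small off a symmetric pair of arcs -/

section IntegerPolynomials
open Polynomial ComplexConjugate

/-! The driving fact is that a nonzero integer has modulus at least `1`. As `ξ` is real, `ρ` misses
an arc together with its conjugate, and then some nonzero integer polynomial `q` satisfies `‖q‖ ≤
1/2` almost everywhere for `ρ` (`exists_int_polynomial_norm_le_half`). Apply `(X - 1) * q ^ k` to
the shift of `ξ`: the factor `X - 1` kills the mean, so the integer-valued result has second moment
`O(4 ^ (-k))` and is nonzero with at most that probability. A union over `2 ^ k` starting points and
Borel–Cantelli show that almost every path is annihilated on `[0, 2 ^ k)` for all large `k`.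

The rest is deterministic up to recurrence. The growing windows let one descend from exponent `k +
1` to `k`, so a single `(X - 1) * q ^ k` annihilates the whole half-line. By Poincaré recurrence the
initial block of the path reappears, which forces periodicity with a period `M` depending on the
path. Only those roots of `(X - 1) * q` that are roots of unity then matter, and they give a common
period `N`. Stationarity carries `ξ N = ξ 0` to every time. -/

lemma normSq_geom_sum_succ {u : ℂ} (hu : ‖u‖ = 1) (n : ℕ) :
    ‖∑ j ∈ Finset.range (n + 1), u ^ j‖ ^ 2 =
      ‖∑ j ∈ Finset.range n, u ^ j‖ ^ 2 + 1 + 2 * (∑ j ∈ Finset.range n, u ^ (j + 1)).re := by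
  have hu1 : u * conj u = 1 := by rw [Complex.mul_conj', hu]; simp
  rw [Finset.sum_range_succ, ← Complex.normSq_eq_norm_sq, Complex.normSq_add,
    Complex.normSq_eq_norm_sq, Complex.normSq_eq_norm_sq, norm_pow, hu]
  have h : (∑ j ∈ Finset.range n, u ^ j) * conj (u ^ n) =
      conj (∑ j ∈ Finset.range n, u ^ (j + 1)) := by
    rw [map_sum, Finset.sum_mul, ← Finset.sum_range_reflect]
    refine Finset.sum_congr rfl fun j hj => ?_
    have hj := Finset.mem_range.1 hj
    obtain ⟨k, rfl⟩ : ∃ k, n = k + (j + 1) := ⟨n - (j + 1), by omega⟩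
    rw [show k + (j + 1) - 1 - j = k by omega, map_pow, map_pow, pow_add, ← mul_assoc, ← mul_pow,
      hu1, one_pow, one_mul]
  rw [h, Complex.conj_re]
  simp

/-- The Fejér kernels centred at `w` and `conj w`, minus their means, are the real part of a real
polynomial without constant term. -/
lemma exists_polynomial_re_eq_fejer {w : ℂ} (hw : ‖w‖ = 1) (n : ℕ) :
    ∃ F : ℝ[X], F.coeff 0 = 0 ∧ ∀ z : ℂ, ‖z‖ = 1 →
      2 * (aeval z F).re = ‖∑ j ∈ Finset.range n, (z * conj w) ^ j‖ ^ 2 +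
        ‖∑ j ∈ Finset.range n, (z * w) ^ j‖ ^ 2 - 2 * n := by
  induction n with
  | zero => exact ⟨0, by simp⟩
  | succ n ih =>
    obtain ⟨F, hF0, hF⟩ := ih
    refine ⟨F + ∑ j ∈ Finset.range n, C (2 * (w ^ (j + 1)).re) * X ^ (j + 1), ?_, fun z hz => ?_⟩
    · simp [hF0, finsetSum_coeff]
    · rw [normSq_geom_sum_succ (by simp [hz, hw]), normSq_geom_sum_succ (by simp [hz, hw]),
        map_add, Complex.add_re, mul_add, hF z hz]
      have : (aeval z (∑ j ∈ Finset.range n, C (2 * (w ^ (j + 1)).re) * X ^ (j + 1) : ℝ[X])).re =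
          (∑ j ∈ Finset.range n, (z * conj w) ^ (j + 1)).re +
          (∑ j ∈ Finset.range n, (z * w) ^ (j + 1)).re := by
        rw [← Complex.add_re, ← Finset.sum_add_distrib, map_sum]
        congr 1
        refine Finset.sum_congr rfl fun j _ => ?_
        rw [map_mul, map_pow, aeval_X, aeval_C, mul_pow, mul_pow, ← mul_add, ← map_pow,
          add_comm (conj _), Complex.add_conj, mul_comm]
        simp
      rw [this]
      push_cast
      ring

lemma norm_geom_sum_le {u : ℂ} (hu : ‖u‖ = 1) {δ : ℝ} (hδ : 0 < δ) (h : δ ≤ ‖u - 1‖) (n : ℕ) :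
    ‖∑ j ∈ Finset.range n, u ^ j‖ ≤ 2 / δ := by
  have h1 : u ≠ 1 := by rintro rfl; simp at h; linarith
  rw [geom_sum_eq h1, norm_div]
  have : ‖u ^ n - 1‖ ≤ 2 := (norm_sub_le _ _).trans (by simp [hu]; norm_num)
  gcongr

/-- A symmetric closed part of the unit circle that omits an arc carries real monic polynomials of
supremum norm less than one. -/
lemma exists_monic_norm_le_lt_one {w : ℂ} (hw : ‖w‖ = 1) {δ : ℝ} (hδ : 0 < δ) :
    ∃ p : ℝ[X], p.Monic ∧ 0 < p.natDegree ∧ ∃ c : ℝ, 0 ≤ c ∧ c < 1 ∧ ∀ z : ℂ, ‖z‖ = 1 →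
      δ ≤ ‖z - w‖ → δ ≤ ‖z - conj w‖ → ‖aeval z p‖ ≤ c := by
  -- Off the arcs each kernel is at most `(2 / δ) ^ 2`, so the subtracted mean `2 * n` dominates and
  -- `Re F ≤ -1`.
  obtain ⟨n, hn⟩ := exists_nat_gt ((2 / δ) ^ 2 + 1)
  obtain ⟨F, hF0, hF⟩ := exists_polynomial_re_eq_fejer hw n
  have hww : w * conj w = 1 := by rw [Complex.mul_conj', hw]; simp
  have hre : ∀ z : ℂ, ‖z‖ = 1 → δ ≤ ‖z - w‖ → δ ≤ ‖z - conj w‖ → (aeval z F).re ≤ -1 := by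
    intro z hz h1 h2
    have e1 : ‖z * conj w - 1‖ = ‖z - w‖ := by
      rw [← hww, ← sub_mul, norm_mul, RCLike.norm_conj, hw, mul_one]
    have e2 : ‖z * w - 1‖ = ‖z - conj w‖ := by
      rw [← hww, mul_comm w (conj w), ← sub_mul, norm_mul, hw, mul_one]
    have b1 := norm_geom_sum_le (u := z * conj w) (by simp [hz, hw]) hδ (e1 ▸ h1) n
    have b2 := norm_geom_sum_le (u := z * w) (by simp [hz, hw]) hδ (e2 ▸ h2) n
    have c1 := pow_le_pow_left₀ (norm_nonneg _) b1 2
    have c2 := pow_le_pow_left₀ (norm_nonneg _) b2 2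
    have := hF z hz
    linarith
  obtain ⟨B, hB⟩ := (isCompact_sphere (0 : ℂ) 1).exists_bound_of_continuousOn
    (f := fun z => aeval z F) (Polynomial.continuous_aeval F).continuousOn
  -- With this `ε`, `|1 + εF|² ≤ 1 - 2ε + ε²B² ≤ 1 - ε` wherever `Re F ≤ -1`.
  set ε : ℝ := 1 / (B ^ 2 + 1) with hε
  have hε0 : 0 < ε := by positivity
  have hεB : ε * (B ^ 2 + 1) = 1 := by rw [hε]; field_simp
  set h : ℝ[X] := 1 + C ε * F with hh
  have hh0 : h.coeff 0 = 1 := by simp [hh, hF0]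
  have hnorm : ∀ z : ℂ, ‖z‖ = 1 → δ ≤ ‖z - w‖ → δ ≤ ‖z - conj w‖ →
      ‖aeval z h‖ ≤ √(1 - ε) := by
    intro z hz h1 h2
    apply Real.le_sqrt_of_sq_le
    have hb : ‖aeval z F‖ ≤ B := hB z (by simpa using hz)
    have hb2 := pow_le_pow_left₀ (norm_nonneg _) hb 2
    have e : aeval z h = 1 + (ε : ℂ) * aeval z F := by simp [hh]
    rw [e, ← Complex.normSq_eq_norm_sq, Complex.normSq_add, Complex.normSq_eq_norm_sq (_ * _),
      norm_mul, mul_pow]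
    have := hre z hz h1 h2
    simp only [map_one, map_mul, Complex.conj_ofReal, one_mul, Complex.re_ofReal_mul,
      Complex.conj_re, Complex.norm_real, Real.norm_eq_abs, sq_abs]
    nlinarith [mul_le_mul_of_nonneg_left hb2 (sq_nonneg ε)]
  -- Reversal turns the constant term `1` into the leading coefficient. On the circle it only
  -- replaces `z` by `conj z` in the modulus, and the omitted arcs are symmetric.
  have hmon : h.reverse.Monic := by
    rw [Monic, reverse_leadingCoeff, trailingCoeff,
      natTrailingDegree_eq_zero.2 (Or.inr (by simp [hh0])), hh0]
  refine ⟨h.reverse * X, hmon.mul monic_X, ?_, √(1 - ε), Real.sqrt_nonneg _, ?_, ?_⟩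
  · rw [hmon.natDegree_mul monic_X, natDegree_X]; omega
  · rw [Real.sqrt_lt' one_pos]; linarith
  · intro z hz h1 h2
    have hz0 : z ≠ 0 := by rintro rfl; simp at hz
    have hzi : z⁻¹ = conj z := Complex.inv_eq_conj hz
    have key : ‖aeval z h.reverse‖ = ‖aeval z⁻¹ h‖ := by
      let _ := invertibleOfNonzero (inv_ne_zero hz0)
      have := eval₂_reverse_mul_pow (algebraMap ℝ ℂ) (z⁻¹) h
      rw [invOf_eq_inv, inv_inv] at this
      rw [aeval_def, aeval_def, ← this, norm_mul, norm_pow, norm_inv, hz]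
      simp
    rw [map_mul, aeval_X, norm_mul, hz, mul_one, key]
    apply hnorm
    · simp [hz]
    · rw [hzi, ← RCLike.norm_conj]; simpa using h2
    · rw [hzi, ← map_sub, RCLike.norm_conj]; exact h1

/-- Coefficients are rounded up from the top: adding a multiple of `p n` in `[0, 1]` makes the
coefficient of `X ^ n` integral and otherwise changes only lower ones. -/
lemma exists_integral_add_sum {p : ℕ → ℝ[X]} (hp : ∀ d, (p d).Monic)
    (hdeg : ∀ d, (p d).natDegree = d) (n : ℕ) (f : ℝ[X]) (hf : f.degree < n) :
    ∃ a : ℕ → ℝ, (∀ d, a d ∈ Set.Icc (0 : ℝ) 1) ∧ ∃ g : ℤ[X],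
      g.map (algebraMap ℤ ℝ) = f + ∑ d ∈ Finset.range n, C (a d) * p d := by
  induction n generalizing f with
  | zero =>
    refine ⟨0, by simp, 0, ?_⟩
    have : f = 0 := by simpa [degree_eq_bot, Nat.WithBot.lt_zero_iff] using hf
    simp [this]
  | succ n ih =>
    set c := f.coeff n
    set s : ℝ := ⌈c⌉ - c with hs
    have hs1 : s ∈ Set.Icc (0 : ℝ) 1 :=
      ⟨by have := Int.le_ceil c; linarith, by have := Int.ceil_lt_add_one c; linarith⟩
    obtain ⟨a, ha, g, hg⟩ := ih (f + C s * p n - C (⌈c⌉ : ℝ) * X ^ n) (by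
      rw [degree_lt_iff_coeff_zero] at hf ⊢
      intro m hm
      rcases hm.eq_or_lt with rfl | hm
      · have : (p n).coeff n = 1 := by
          have := (hp n).coeff_natDegree; rwa [hdeg] at this
        rw [coeff_sub, coeff_add, coeff_C_mul, coeff_C_mul, this, coeff_X_pow_self]
        simp only [hs, c]
        ring
      · have : (p n).coeff m = 0 := coeff_eq_zero_of_natDegree_lt (by rwa [hdeg])
        simp [this, hf m hm, coeff_X_pow, hm.ne'])
    refine ⟨Function.update a n s, fun d => ?_, g + C ⌈c⌉ * X ^ n, ?_⟩
    · by_cases h : d = n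
      · subst h; simpa using hs1
      · simpa [h] using ha d
    · rw [Finset.sum_range_succ, Polynomial.map_add, hg]
      have : ∑ d ∈ Finset.range n, C (Function.update a n s d) * p d =
          ∑ d ∈ Finset.range n, C (a d) * p d :=
        Finset.sum_congr rfl fun d hd => by
          rw [Function.update_of_ne (Finset.mem_range.1 hd).ne]
      rw [this]
      simp
      ring

/-- If the polynomials `p d`, monic of degree `d`, are uniformly summable on `K`, then some nonzero
integer polynomial is at most `1 / 2` in modulus on `K`. -/
lemma exists_int_polynomial_of_summable {K : Set ℂ} {p : ℕ → ℝ[X]} (hp : ∀ d, (p d).Monic)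
    (hdeg : ∀ d, (p d).natDegree = d) {b : ℕ → ℝ} (hb : Summable b)
    (hb1 : ∀ d, b d ≤ 1) (hpb : ∀ z ∈ K, ∀ d, ‖aeval z (p d)‖ ≤ b d) :
    ∃ q : ℤ[X], q ≠ 0 ∧ ∀ z ∈ K, ‖aeval z q‖ ≤ 1 / 2 := by
  have hex : ∀ N : ℕ, ∃ a : ℕ → ℝ, (∀ d, a d ∈ Set.Icc (0 : ℝ) 1) ∧ ∃ g : ℤ[X],
      g.map (algebraMap ℤ ℝ) = p N + ∑ d ∈ Finset.range N, C (a d) * p d := by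
    intro N
    obtain ⟨a, ha, g, hg⟩ := exists_integral_add_sum hp hdeg N (p N - X ^ N) (by
      have : (p N).degree = N := by
        rw [degree_eq_natDegree (hp N).ne_zero, hdeg]
      rw [← this]
      apply degree_sub_lt_left _ (hp N).ne_zero (by simp [(hp N).leadingCoeff])
      rw [this, degree_X_pow])
    exact ⟨a, ha, g + X ^ N, by rw [Polynomial.map_add, hg]; simp; ring⟩
  choose a ha g hg using hex
  have hgc : ∀ N M, N < M → (g N).coeff M = 0 := by
    intro N M hNM
    have : ((g N).map (algebraMap ℤ ℝ)).coeff M = 0 := by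
      rw [hg, coeff_add, finsetSum_coeff, coeff_eq_zero_of_natDegree_lt (by rwa [hdeg]),
        Finset.sum_eq_zero, add_zero]
      intro d hd
      rw [coeff_C_mul, coeff_eq_zero_of_natDegree_lt, mul_zero]
      rw [hdeg]; exact (Finset.mem_range.1 hd).trans hNM
    simpa [coeff_map] using this
  have hgc1 : ∀ N, (g N).coeff N = 1 := by
    intro N
    have : ((g N).map (algebraMap ℤ ℝ)).coeff N = 1 := by
      have h1 : (p N).coeff N = 1 := by have := (hp N).coeff_natDegree; rwa [hdeg] at this
      rw [hg, coeff_add, finsetSum_coeff, h1, Finset.sum_eq_zero, add_zero]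
      intro d hd
      rw [coeff_C_mul, coeff_eq_zero_of_natDegree_lt, mul_zero]
      rw [hdeg]; exact (Finset.mem_range.1 hd)
    rw [coeff_map, eq_intCast] at this
    exact_mod_cast this
  -- Beyond `D` the corrections are uniformly negligible, so `g N` is governed on `K` by its first
  -- `D` weights `a N d`.
  obtain ⟨D, hD⟩ := Metric.cauchySeq_iff'.1 hb.hasSum.tendsto_sum_nat.cauchySeq (1 / 8) (by norm_num)
  have htail : ∀ N, D ≤ N → ∀ z ∈ K, ‖aeval z (g N) - ∑ d ∈ Finset.range D,
      (a N d : ℂ) * aeval z (p d)‖ ≤ 1 / 8 := by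
    intro N hN z hz
    have e : aeval z (g N) = aeval z (p N) + ∑ d ∈ Finset.range N, (a N d : ℂ) * aeval z (p d) := by
      rw [← aeval_map_algebraMap ℝ, hg]; simp
    rw [e, ← Finset.sum_range_add_sum_Ico _ hN, add_sub_assoc, add_sub_cancel_left]
    have h1 : ‖∑ d ∈ Finset.Ico D N, (a N d : ℂ) * aeval z (p d)‖ ≤ ∑ d ∈ Finset.Ico D N, b d := by
      refine norm_sum_le_of_le _ fun d _ => ?_
      rw [norm_mul, Complex.norm_real, Real.norm_of_nonneg (ha N d).1]
      calc _ ≤ 1 * ‖aeval z (p d)‖ := by gcongr; exact (ha N d).2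
        _ ≤ _ := by rw [one_mul]; exact hpb z hz d
    have h2 := hD (N + 1) (by omega)
    rw [Real.dist_eq, ← Finset.sum_range_add_sum_Ico _ (by omega : D ≤ N + 1), add_sub_cancel_left,
      Finset.sum_Ico_succ_top hN] at h2
    have h3 := (le_abs_self _).trans h2.le
    exact (norm_add_le _ _).trans (by linarith [hpb z hz N])
  -- Pigeonhole by compactness of the cube `[0, 1] ^ D`: two indices `N < M` have nearly equal
  -- weights, so `g M - g N` is small on `K`. It is nonzero because its coefficient at `X ^ M` is
  -- `1`.
  let v : ℕ → (Fin D → ℝ) := fun i d => a (D + i) d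
  obtain ⟨l, -, φ, hφ, hlim⟩ := (isCompact_Icc (a := (0 : Fin D → ℝ)) (b := 1)).tendsto_subseq
    (x := v) (fun i => ⟨fun d => (ha _ _).1, fun d => (ha _ _).2⟩)
  obtain ⟨i, hi⟩ := Metric.cauchySeq_iff'.1 hlim.cauchySeq (1 / (8 * (D + 1))) (by positivity)
  have hclose := hi (i + 1) (by omega)
  set N := D + φ i
  set M := D + φ (i + 1)
  have hNM : N < M := by have := hφ (Nat.lt_succ_self i); simp only [N, M]; simpa using this
  refine ⟨g M - g N, fun h => ?_, fun z hz => ?_⟩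
  · have := congrArg (fun r => r.coeff M) h
    simp [hgc1, hgc N M hNM] at this
  · have t1 := htail M (by omega) z hz
    have t2 := htail N (by omega) z hz
    have t3 : ‖∑ d ∈ Finset.range D, (a M d : ℂ) * aeval z (p d) -
        ∑ d ∈ Finset.range D, (a N d : ℂ) * aeval z (p d)‖ ≤ 1 / 8 := by
      rw [← Finset.sum_sub_distrib]
      calc _ ≤ ∑ d ∈ Finset.range D, 1 / (8 * (D + 1 : ℝ)) := by
            refine norm_sum_le_of_le _ fun d hd => ?_
            have hd := Finset.mem_range.1 hd
            have hdist := (dist_le_pi_dist _ _ (⟨d, hd⟩ : Fin D)).trans hclose.le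
            rw [← sub_mul, norm_mul, ← Complex.ofReal_sub, Complex.norm_real]
            calc _ ≤ 1 / (8 * (D + 1 : ℝ)) * 1 := by
                  gcongr
                  · exact hdist
                  · exact (hpb z hz d).trans (hb1 d)
              _ = _ := mul_one _
        _ ≤ 1 / 8 := by
            rw [Finset.sum_const, Finset.card_range, nsmul_eq_mul, mul_one_div,
              div_le_div_iff₀ (by positivity) (by norm_num)]
            linarith
    rw [map_sub]
    have e : aeval z (g M) - aeval z (g N) =
      (aeval z (g M) - ∑ d ∈ Finset.range D, (a M d : ℂ) * aeval z (p d)) -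
      (aeval z (g N) - ∑ d ∈ Finset.range D, (a N d : ℂ) * aeval z (p d)) +
      (∑ d ∈ Finset.range D, (a M d : ℂ) * aeval z (p d) -
        ∑ d ∈ Finset.range D, (a N d : ℂ) * aeval z (p d)) := by ring
    rw [e]
    refine (norm_add_le _ _).trans ?_
    have := norm_sub_le (aeval z (g M) - ∑ d ∈ Finset.range D, (a M d : ℂ) * aeval z (p d))
      (aeval z (g N) - ∑ d ∈ Finset.range D, (a N d : ℂ) * aeval z (p d))
    linarith

/-- Powers of a monic `p` with supremum norm `c < 1`, padded by powers of `X`, give one monic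
polynomial in each degree. Their bounds are geometric, constant on blocks of length `p.natDegree`.
-/
lemma exists_int_polynomial_norm_le_half {w : ℂ} (hw : ‖w‖ = 1) {δ : ℝ} (hδ : 0 < δ) :
    ∃ q : ℤ[X], q ≠ 0 ∧ ∀ z : ℂ, ‖z‖ = 1 → δ ≤ ‖z - w‖ → δ ≤ ‖z - conj w‖ →
      ‖aeval z q‖ ≤ 1 / 2 := by
  obtain ⟨p, hp, hm, c, hc0, hc1, hpc⟩ := exists_monic_norm_le_lt_one hw hδ
  have : NeZero p.natDegree := ⟨hm.ne'⟩
  have hsum : Summable fun d : ℕ => c ^ (d / p.natDegree) := by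
    have h1 : Summable fun x : ℕ × Fin p.natDegree => c ^ x.1 * 1 :=
      (summable_geometric_of_lt_one hc0 hc1).mul_of_nonneg (g := fun _ : Fin p.natDegree => (1 : ℝ))
        ((hasSum_fintype _).summable) (fun _ => by positivity) (fun _ => zero_le_one)
    have h2 := (Nat.divModEquiv p.natDegree).summable_iff.2 h1
    simpa [Function.comp_def] using h2
  obtain ⟨q, hq, h⟩ := exists_int_polynomial_of_summable
    (K := {z : ℂ | ‖z‖ = 1 ∧ δ ≤ ‖z - w‖ ∧ δ ≤ ‖z - conj w‖})
    (p := fun d => p ^ (d / p.natDegree) * X ^ (d % p.natDegree))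
    (fun d => (hp.pow _).mul (monic_X_pow _))
    (fun d => by
      rw [(hp.pow _).natDegree_mul (monic_X_pow _), hp.natDegree_pow, natDegree_X_pow,
        Nat.div_add_mod'])
    hsum (fun d => pow_le_one₀ hc0 hc1.le)
    (fun z hz d => by
      rw [map_mul, map_pow, map_pow, aeval_X, norm_mul, norm_pow, norm_pow, hz.1, one_pow, mul_one]
      exact pow_le_pow_left₀ (norm_nonneg _) (hpc z hz.1 hz.2.1 hz.2.2) _)
  exact ⟨q, hq, fun z h1 h2 h3 => h z ⟨h1, h2, h3⟩⟩

end IntegerPolynomials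

/-! ### Linear recurrences, propagation and periods -/

section LinearRecurrences
open Polynomial

/-- The one-sided shift on complex sequences. -/
def seqShift : (ℕ → ℂ) →ₗ[ℂ] (ℕ → ℂ) where
  toFun x n := x (n + 1)
  map_add' _ _ := rfl
  map_smul' _ _ := rfl

lemma seqShift_pow_apply (k : ℕ) (x : ℕ → ℂ) (n : ℕ) : (seqShift ^ k) x n = x (n + k) := by
  induction k generalizing x n with
  | zero => simp
  | succ k ih =>
    rw [pow_succ, Module.End.mul_apply, ih]
    change x (n + k + 1) = _
    rw [add_assoc]

lemma aeval_seqShift_apply (Q : ℂ[X]) (x : ℕ → ℂ) (n : ℕ) :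
    aeval seqShift Q x n = ∑ j ∈ Finset.range (Q.natDegree + 1), Q.coeff j * x (n + j) := by
  rw [aeval_eq_sum_range, LinearMap.sum_apply, Finset.sum_apply]
  simp [seqShift_pow_apply]

lemma aeval_seqShift_intCast (Q : ℤ[X]) (x : ℕ → ℤ) (n : ℕ) :
    aeval seqShift (Q.map (algebraMap ℤ ℂ)) (fun k => (x k : ℂ)) n =
      ((∑ j ∈ Finset.range (Q.natDegree + 1), Q.coeff j * x (n + j) : ℤ) : ℂ) := by
  rw [aeval_seqShift_apply, natDegree_map_eq_of_injective (algebraMap ℤ ℂ).injective_int]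
  simp

/-- A solution of a linear recurrence on an initial segment is determined by its first values. -/
lemma eq_zero_of_aeval_seqShift_eq_zero {Q : ℂ[X]} (hQ : Q ≠ 0) {x : ℕ → ℂ} {L : ℕ}
    (h0 : ∀ n < Q.natDegree, x n = 0) (h : ∀ n < L, aeval seqShift Q x n = 0) :
    ∀ n < L, x n = 0 := by
  intro n
  induction n using Nat.strong_induction_on with
  | _ n ih =>
    intro hn
    by_cases hd : n < Q.natDegree
    · exact h0 n hd
    obtain ⟨m, rfl⟩ := Nat.exists_eq_add_of_le' (not_lt.1 hd)
    have := h m (by omega)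
    rw [aeval_seqShift_apply, Finset.sum_range_succ, Finset.sum_eq_zero, zero_add] at this
    · exact (mul_eq_zero.1 this).resolve_left (leadingCoeff_ne_zero.2 hQ)
    · intro j hj
      have := Finset.mem_range.1 hj
      rw [ih _ (by omega) (by omega), mul_zero]

lemma aeval_seqShift_eq_zero_of_eventually {Q q : ℂ[X]} (hq : q ≠ 0) {x : ℕ → ℂ}
    (h : ∀ᶠ k in Filter.atTop, ∀ n < 2 ^ k, aeval seqShift (Q * q ^ k) x n = 0) :
    ∃ k, aeval seqShift (Q * q ^ k) x = 0 := by
  obtain ⟨k₀, h⟩ := Filter.eventually_atTop.1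
    (h.and (Filter.eventually_ge_atTop q.natDegree))
  refine ⟨k₀, funext fun n => ?_⟩
  -- The sequence `y = (Q * q ^ j)(S) x`, with `S` the shift, solves the recurrence `q` on the
  -- window of exponent `j + 1`. It vanishes on its first `2 ^ j ≥ deg q` terms, hence on that
  -- longer window; iterate.
  have key : ∀ m, ∀ j ≥ k₀, ∀ n < 2 ^ (j + m), aeval seqShift (Q * q ^ j) x n = 0 := by
    intro m
    induction m with
    | zero => exact fun j hj n hn => (h j hj).1 n hn
    | succ m ih =>
      intro j hj
      apply eq_zero_of_aeval_seqShift_eq_zero hq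
      · intro n hn
        exact (h j hj).1 n (hn.trans_le ((h j hj).2.trans Nat.lt_two_pow_self.le))
      · intro n hn
        rw [← Module.End.mul_apply, ← map_mul, mul_comm q, mul_assoc, ← pow_succ]
        exact ih (j + 1) (by omega) n (by rwa [show j + 1 + m = j + (m + 1) by ring])
  exact key n k₀ le_rfl n (Nat.lt_two_pow_self.trans_le (Nat.pow_le_pow_right two_pos (by omega)))

lemma exists_common_exponent (Q : ℂ[X]) :
    ∃ N : ℕ, 0 < N ∧ ∀ z ∈ Q.roots, ∀ M : ℕ, 0 < M → z ^ M = 1 → z ^ N = 1 := by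
  -- Roots of infinite order have `orderOf` equal to `0` and contribute the factor `1`.
  refine ⟨∏ z ∈ Q.roots.toFinset, if orderOf z = 0 then 1 else orderOf z,
    Finset.prod_pos fun z _ => by split_ifs <;> omega, fun z hz M hM h => ?_⟩
  have h0 : orderOf z ≠ 0 := orderOf_ne_zero_iff.2 (isOfFinOrder_iff_pow_eq_one.2 ⟨M, hM, h⟩)
  rw [← orderOf_dvd_iff_pow_eq_one]
  have := Finset.dvd_prod_of_mem (fun z => if orderOf z = 0 then 1 else orderOf z)
    (Multiset.mem_toFinset.2 hz)
  simpa [h0] using this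

/-- Divisors of the separable `X ^ M - 1` have simple roots, so multiplicities, in particular those
coming from `q ^ k`, play no role. -/
lemma dvd_X_pow_sub_one_of_roots {g : ℂ[X]} {N M : ℕ} (hN : 0 < N) (hM : 0 < M)
    (hg : g ∣ X ^ M - 1) (h : ∀ z ∈ g.roots, z ^ N = 1) : g ∣ X ^ N - 1 := by
  have hM1 : (X ^ M - 1 : ℂ[X]) ≠ 0 := X_pow_sub_C_ne_zero hM 1
  have hN1 : (X ^ N - 1 : ℂ[X]) ≠ 0 := X_pow_sub_C_ne_zero hN 1
  have hg0 : g ≠ 0 := ne_zero_of_dvd_ne_zero hM1 hg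
  have hsep : (X ^ M - 1 : ℂ[X]).Separable :=
    separable_X_pow_sub_C 1 (by exact_mod_cast hM.ne') one_ne_zero
  have hnd : g.roots.Nodup := nodup_roots (hsep.of_dvd hg)
  refine (IsAlgClosed.splits g).dvd_of_roots_le_roots hg0 ?_
  rw [Multiset.le_iff_subset hnd]
  intro z hz
  rw [mem_roots hN1]
  simp [h z hz]

/-- A recurrent solution of a linear recurrence `Q * q ^ k` is periodic, with a period that depends
on `Q * q` only. -/
lemma exists_period_of_recurrent {Q q : ℂ[X]} (hQ : Q ≠ 0) (hq : q ≠ 0) :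
    ∃ N : ℕ, 0 < N ∧ ∀ x : ℕ → ℂ, (∃ k, aeval seqShift (Q * q ^ k) x = 0) →
      (∀ D : ℕ, ∃ M : ℕ, 0 < M ∧ ∀ j < D, x (j + M) = x j) → ∀ n, x (n + N) = x n := by
  obtain ⟨N, hN, hroots⟩ := exists_common_exponent (Q * q)
  refine ⟨N, hN, ?_⟩
  rintro x ⟨k, hk⟩ hrec n
  set R := Q * q ^ k with hR
  have hR0 : R ≠ 0 := mul_ne_zero hQ (pow_ne_zero _ hq)
  obtain ⟨M, hM, hMx⟩ := hrec R.natDegree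
  -- The difference of `x` and its translate solves the recurrence `R` with zero initial values.
  have hper : aeval seqShift (X ^ M - 1 : ℂ[X]) x = 0 := by
    funext m
    refine eq_zero_of_aeval_seqShift_eq_zero hR0 (L := m + 1) ?_ ?_ m (by omega)
    · intro n hn
      simp [seqShift_pow_apply, hMx n hn]
    · intro n _
      rw [← Module.End.mul_apply, ← map_mul, mul_comm, map_mul, Module.End.mul_apply, hk, map_zero]
      rfl
  set g := EuclideanDomain.gcd (X ^ M - 1) R with hg
  have hgx : aeval seqShift g x = 0 := by
    rw [hg, EuclideanDomain.gcd_eq_gcd_ab, mul_comm, mul_comm R, map_add, map_mul, map_mul,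
      LinearMap.add_apply, Module.End.mul_apply, Module.End.mul_apply, hper, hk]
    simp
  have hgR : g ∣ R := EuclideanDomain.gcd_dvd_right _ _
  have hgM : g ∣ X ^ M - 1 := EuclideanDomain.gcd_dvd_left _ _
  obtain ⟨s, hs⟩ := dvd_X_pow_sub_one_of_roots hN hM hgM fun z hz => by
    have hgz : g.IsRoot z := isRoot_of_mem_roots hz
    refine hroots z ?_ M hM ?_
    · have h1 := hgz.dvd hgR
      rw [mem_roots (mul_ne_zero hQ hq)]
      simp only [IsRoot, hR, eval_mul, eval_pow, mul_eq_zero] at h1 ⊢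
      exact h1.imp id eq_zero_of_pow_eq_zero
    · have h1 := hgz.dvd hgM
      simpa [IsRoot, sub_eq_zero] using h1
  have hNx : aeval seqShift (X ^ N - 1 : ℂ[X]) x = 0 := by
    rw [hs, mul_comm, map_mul, Module.End.mul_apply, hgx, map_zero]
  have := congrFun hNx n
  simpa [seqShift_pow_apply, sub_eq_zero] using this

end LinearRecurrences

/-! ### Symmetry of the spectral measure and the second-moment bound -/

section SpectralMeasure
open ComplexConjugate Polynomial

/-- The character `t ↦ t ^ m` of the unit circle. -/
noncomputable def circleChar (m : ℤ) : BoundedContinuousFunction Circle ℂ :=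
  BoundedContinuousFunction.mkOfCompact ⟨fun t => ((t ^ m : Circle) : ℂ),
    continuous_subtype_val.comp (continuous_zpow m)⟩

lemma circleChar_apply (m : ℤ) (t : Circle) : circleChar m t = ((t ^ m : Circle) : ℂ) := rfl

/-- The star algebra of trigonometric polynomials on the unit circle. -/
noncomputable def circleTrigPoly : StarSubalgebra ℂ (BoundedContinuousFunction Circle ℂ) where
  toSubalgebra := Algebra.adjoin ℂ (Set.range circleChar)
  star_mem' := by
    change Algebra.adjoin ℂ (Set.range circleChar) ≤ star (Algebra.adjoin ℂ (Set.range circleChar))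
    refine Algebra.adjoin_le ?_
    rintro - ⟨m, rfl⟩
    refine Algebra.subset_adjoin ⟨-m, ?_⟩
    ext t
    simp only [BoundedContinuousFunction.star_apply, circleChar_apply, zpow_neg, Circle.coe_inv_eq_conj]
    rfl

lemma mem_span_of_mem_circleTrigPoly {g : BoundedContinuousFunction Circle ℂ}
    (hg : g ∈ circleTrigPoly) : g ∈ Submodule.span ℂ (Set.range circleChar) := by
  have h : Subalgebra.toSubmodule (Algebra.adjoin ℂ (Set.range circleChar)) =
      Submodule.span ℂ (Set.range circleChar) := by
    apply Algebra.adjoin_eq_span_of_subset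
    refine Set.Subset.trans ?_ Submodule.subset_span
    intro x hx
    refine Submonoid.closure_induction (fun _ => id) ⟨0, ?_⟩ ?_ hx
    · ext t; simp [circleChar_apply]
    · rintro - - - - ⟨m, rfl⟩ ⟨n, rfl⟩
      refine ⟨m + n, ?_⟩
      ext t
      simp [circleChar_apply, zpow_add]
  rw [← h]
  exact hg

/-- Finite measures on the unit circle are determined by their Fourier coefficients. -/
lemma Circle.measure_ext_of_integral_zpow {ρ ν : Measure Circle} [IsFiniteMeasure ρ]
    [IsFiniteMeasure ν]
    (h : ∀ m : ℤ, ∫ t : Circle, ((t ^ m : Circle) : ℂ) ∂ρ = ∫ t : Circle, ((t ^ m : Circle) : ℂ) ∂ν) :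
    ρ = ν := by
  refine ext_of_forall_mem_subalgebra_integral_eq_of_polish (𝕜 := ℂ) (A := circleTrigPoly) ?_ ?_
  · intro x y hxy
    refine ⟨fun t => circleChar 1 t, ⟨_, ⟨circleChar 1, Algebra.subset_adjoin ⟨1, rfl⟩, rfl⟩, rfl⟩, ?_⟩
    simpa [circleChar_apply] using fun h => hxy (Circle.coe_injective h)
  · intro g hg
    refine Submodule.span_induction ?_ ?_ ?_ ?_ (mem_span_of_mem_circleTrigPoly hg)
    · rintro - ⟨m, rfl⟩
      exact h m
    · simp
    · intro f g _ _ hf hg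
      simp only [BoundedContinuousFunction.coe_add, Pi.add_apply]
      rw [integral_add (f.integrable _) (g.integrable _),
        integral_add (f.integrable _) (g.integrable _), hf, hg]
    · intro a f _ hf
      simp only [BoundedContinuousFunction.coe_smul]
      rw [integral_smul, integral_smul, hf]

variable {Ω : Type*} [MeasurableSpace Ω] {P : Measure Ω} {ξ : ℤ → Ω → ℤ} {ρ : Measure Circle}

lemma conj_covarianceFunction_intCast (m : ℤ) :
    conj (covarianceFunction P (fun n ω => (ξ n ω : ℂ)) m) =
      covarianceFunction P (fun n ω => (ξ n ω : ℂ)) m := by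
  have h : ∀ n, conj (∫ ω, (ξ n ω : ℂ) ∂P) = ∫ ω, (ξ n ω : ℂ) ∂P := fun n => by
    rw [← integral_conj]; simp
  rw [covarianceFunction, ← integral_conj]
  simp [h]

/-- The spectral measure of a real process is symmetric. -/
lemma IsSpectralMeasure.map_inv (hρ : IsSpectralMeasure P (fun n ω => (ξ n ω : ℂ)) ρ) :
    ρ.map (fun t => t⁻¹) = ρ := by
  have := hρ.isFiniteMeasure
  have hm : Measurable (fun t : Circle => t⁻¹) := continuous_inv.measurable
  refine Circle.measure_ext_of_integral_zpow fun m => ?_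
  rw [integral_map (f := fun t : Circle => ((t ^ m : Circle) : ℂ)) hm.aemeasurable
    (circleChar m).continuous.aestronglyMeasurable]
  have h := conj_covarianceFunction_intCast (P := P) (ξ := ξ) (-m)
  rw [hρ.fourier_eq, ← integral_conj, neg_neg] at h
  rw [← h]
  congr 1
  ext t
  rw [inv_zpow, Circle.coe_inv_eq_conj]

/-- Outside its support the spectral measure of a real process has a symmetric gap. -/
lemma IsSpectralMeasure.exists_gap (hρ : IsSpectralMeasure P (fun n ω => (ξ n ω : ℂ)) ρ)
    (hspt : ρ.support ≠ Set.univ) :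
    ∃ w : ℂ, ‖w‖ = 1 ∧ ∃ δ > 0, ∀ᵐ t : Circle ∂ρ, δ ≤ ‖(t : ℂ) - w‖ ∧ δ ≤ ‖(t : ℂ) - conj w‖ := by
  obtain ⟨w, hw⟩ := (Set.ne_univ_iff_exists_notMem _).1 hspt
  obtain ⟨U, hU, hU0⟩ := Measure.notMem_support_iff_exists.1 hw
  obtain ⟨δ, hδ, hball⟩ := Metric.mem_nhds_iff.1 hU
  have hm : Measurable (fun t : Circle => t⁻¹) := continuous_inv.measurable
  have h1 : ∀ᵐ t : Circle ∂ρ, δ ≤ ‖(t : ℂ) - w‖ := by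
    refine measure_mono_null (fun t ht => hball ?_) hU0
    change dist (t : ℂ) w < δ
    simpa [dist_eq_norm] using ht
  refine ⟨w, Circle.norm_coe w, δ, hδ, ?_⟩
  have h2 : ∀ᵐ t : Circle ∂ρ, δ ≤ ‖((t⁻¹ : Circle) : ℂ) - w‖ := by
    rw [← hρ.map_inv] at h1
    exact ae_of_ae_map hm.aemeasurable h1
  filter_upwards [h1, h2] with t h1 h2
  refine ⟨h1, ?_⟩
  rw [Circle.coe_inv_eq_conj, ← RCLike.norm_conj] at h2
  simpa using h2

lemma IsStationaryProcess.comp_shift {S T : Type*} [MeasurableSpace S] [MeasurableSpace T]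
    {ξ : ℤ → Ω → S} (hstat : IsStationaryProcess P ξ) (k : ℤ) {u : (ℤ → S) → T}
    (hu : Measurable u) :
    IdentDistrib (fun ω => u fun n => ξ (n + k) ω) (fun ω => u fun n => ξ n ω) P P :=
  (hstat k).comp hu

lemma IsStationaryProcess.memLp_intCast (hstat : IsStationaryProcess P ξ)
    (hL2 : MemLp (fun ω => (ξ 0 ω : ℂ)) 2 P) (n : ℤ) : MemLp (fun ω => (ξ n ω : ℂ)) 2 P := by
  have := hstat.comp_shift n (u := fun x => (x 0 : ℂ)) (by fun_prop)
  simpa using this.memLp_iff.2 hL2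

lemma IsStationaryProcess.integral_intCast (hstat : IsStationaryProcess P ξ) (n : ℤ) :
    ∫ ω, (ξ n ω : ℂ) ∂P = ∫ ω, (ξ 0 ω : ℂ) ∂P := by
  have := hstat.comp_shift n (u := fun x => (x 0 : ℂ)) (by fun_prop)
  simpa using this.integral_eq

lemma IsSpectralMeasure.integral_mul_conj (hstat : IsStationaryProcess P ξ)
    (hρ : IsSpectralMeasure P (fun n ω => (ξ n ω : ℂ)) ρ) {c : ℂ} (hc : ∫ ω, (ξ 0 ω : ℂ) ∂P = c)
    (a b : ℤ) :
    ∫ ω, ((ξ a ω : ℂ) - c) * conj ((ξ b ω : ℂ) - c) ∂P =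
      ∫ t : Circle, ((t ^ a : Circle) : ℂ) * conj ((t ^ b : Circle) : ℂ) ∂ρ := by
  have h := (hstat.comp_shift a
    (u := fun x => ((x 0 : ℂ) - c) * conj ((x (b - a) : ℂ) - c)) (by fun_prop)).integral_eq
  simp only [zero_add, sub_add_cancel] at h
  have h2 := hρ.fourier_eq (b - a)
  simp only [covarianceFunction, hstat.integral_intCast (b - a), hc] at h2
  rw [h, h2]
  congr 1
  ext t
  rw [← Circle.coe_inv_eq_conj, ← Circle.coe_mul, ← zpow_neg, ← zpow_add]
  congr 2
  ring

/-- Applying an integer polynomial that vanishes at `1` to the shift of an integer-valued process,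
the probability of a nonzero value is controlled by the spectral measure. -/
lemma IsSpectralMeasure.measureReal_ne_zero_le [IsProbabilityMeasure P]
    (hstat : IsStationaryProcess P ξ)
    (hL2 : MemLp (fun ω => (ξ 0 ω : ℂ)) 2 P)
    (hρ : IsSpectralMeasure P (fun n ω => (ξ n ω : ℂ)) ρ) (Q : ℤ[X]) (hQ : Q.eval 1 = 0) (n : ℤ) :
    P.real {ω | ∑ j ∈ Finset.range (Q.natDegree + 1), Q.coeff j * ξ (n + j) ω ≠ 0} ≤
      ∫ t : Circle, ‖aeval (t : ℂ) Q‖ ^ 2 ∂ρ := by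
  have := hρ.isFiniteMeasure
  set I := Finset.range (Q.natDegree + 1)
  set c := ∫ ω, (ξ 0 ω : ℂ) ∂P with hc
  set Y : Ω → ℤ := fun ω => ∑ j ∈ I, Q.coeff j * ξ (n + j) ω with hY
  set ζ : ℕ → Ω → ℂ := fun j ω => (ξ (n + j) ω : ℂ) - c with hζ
  have hYζ : ∀ ω, (Y ω : ℂ) = ∑ j ∈ I, (Q.coeff j : ℂ) * ζ j ω := by
    intro ω
    -- `Q(1) = 0` makes the combination insensitive to the mean, so `ξ` may be centered.
    have h0 : ∑ j ∈ I, (Q.coeff j : ℂ) = 0 := by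
      rw [eval_eq_sum_range] at hQ
      simp only [one_pow, mul_one] at hQ
      exact_mod_cast congrArg (Int.cast : ℤ → ℂ) hQ
    simp only [hζ, mul_sub, Finset.sum_sub_distrib, ← Finset.sum_mul, h0, zero_mul, sub_zero, hY]
    push_cast
    rfl
  have hζL : ∀ j, MemLp (ζ j) 2 P := fun j =>
    (hstat.memLp_intCast hL2 _).sub (memLp_const c)
  have hint : ∀ j l, Integrable (fun ω => ζ j ω * conj (ζ l ω)) P := fun j l =>
    (hζL j).integrable_mul (hζL l).star
  have hsq : ∀ ω, ((‖(Y ω : ℂ)‖ ^ 2 : ℝ) : ℂ) =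
      ∑ j ∈ I, ∑ l ∈ I, ((Q.coeff j : ℂ) * Q.coeff l) * (ζ j ω * conj (ζ l ω)) := by
    intro ω
    rw [Complex.ofReal_pow, ← Complex.mul_conj', hYζ, map_sum, Finset.sum_mul_sum]
    refine Finset.sum_congr rfl fun j _ => Finset.sum_congr rfl fun l _ => ?_
    rw [map_mul, map_intCast]
    ring
  have hsqt : ∀ t : Circle, ((‖aeval (t : ℂ) Q‖ ^ 2 : ℝ) : ℂ) =
      ∑ j ∈ I, ∑ l ∈ I, ((Q.coeff j : ℂ) * Q.coeff l) *
        (((t ^ (n + j) : Circle) : ℂ) * conj ((t ^ (n + l) : Circle) : ℂ)) := by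
    intro t
    rw [Complex.ofReal_pow, ← Complex.mul_conj', aeval_eq_sum_range, map_sum, Finset.sum_mul_sum]
    refine Finset.sum_congr rfl fun j _ => Finset.sum_congr rfl fun l _ => ?_
    have hn : ((t ^ n : Circle) : ℂ) * conj ((t ^ n : Circle) : ℂ) = 1 := by
      rw [Complex.mul_conj', Circle.norm_coe]; simp
    rw [zpow_add, zpow_add, Circle.coe_mul, Circle.coe_mul, map_mul, zpow_natCast, zpow_natCast,
      Circle.coe_pow, Circle.coe_pow, zsmul_eq_mul, zsmul_eq_mul, map_mul, map_intCast]
    linear_combination (-(Q.coeff j : ℂ) * Q.coeff l * (t : ℂ) ^ j * conj ((t : ℂ) ^ l)) * hn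
  have hYint : Integrable (fun ω => ‖(Y ω : ℂ)‖ ^ 2) P := by
    have : Integrable (fun ω => ((‖(Y ω : ℂ)‖ ^ 2 : ℝ) : ℂ)) P := by
      simp_rw [hsq]
      exact integrable_finsetSum _ fun j _ => integrable_finsetSum _ fun l _ =>
        (hint j l).const_mul _
    exact this.re
  have heq : ∫ ω, ‖(Y ω : ℂ)‖ ^ 2 ∂P = ∫ t : Circle, ‖aeval (t : ℂ) Q‖ ^ 2 ∂ρ := by
    rw [← Complex.ofReal_inj, ← integral_complex_ofReal, ← integral_complex_ofReal]
    simp_rw [hsq, hsqt]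
    have hint2 : ∀ j l : ℕ, Integrable (fun t : Circle =>
        ((t ^ (n + j) : Circle) : ℂ) * conj ((t ^ (n + l) : Circle) : ℂ)) ρ := fun j l =>
      (circleChar (n + j) * star (circleChar (n + l))).integrable ρ
    rw [integral_finsetSum _ fun j _ => integrable_finsetSum _ fun l _ => (hint j l).const_mul _,
      integral_finsetSum _ fun j _ => integrable_finsetSum _ fun l _ => (hint2 j l).const_mul _]
    refine Finset.sum_congr rfl fun j _ => ?_
    rw [integral_finsetSum _ fun l _ => (hint j l).const_mul _,
      integral_finsetSum _ fun l _ => (hint2 j l).const_mul _]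
    refine Finset.sum_congr rfl fun l _ => ?_
    rw [integral_const_mul, integral_const_mul, hρ.integral_mul_conj hstat rfl]
  rw [← heq]
  -- Markov at level `1`: a nonzero integer has square at least `1`.
  have hmarkov := mul_meas_ge_le_integral_of_nonneg (μ := P)
    (Filter.Eventually.of_forall fun ω => sq_nonneg ‖(Y ω : ℂ)‖) hYint 1
  rw [one_mul] at hmarkov
  refine le_trans (measureReal_mono fun ω hω => ?_) hmarkov
  have h1 : (1 : ℝ) ≤ |(Y ω : ℝ)| := by exact_mod_cast Int.one_le_abs hω
  have h2 : ‖(Y ω : ℂ)‖ = |(Y ω : ℝ)| := by simp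
  change (1 : ℝ) ≤ ‖(Y ω : ℂ)‖ ^ 2
  rw [h2]
  exact one_le_pow₀ h1

end SpectralMeasure

/-! ### Recurrence and Borel–Cantelli -/

section Periodicity
open Polynomial

variable {Ω : Type*} [MeasurableSpace Ω] {P : Measure Ω} [IsProbabilityMeasure P] {ξ : ℤ → Ω → ℤ}

/-- Poincaré recurrence for stationary processes with countably many values. -/
lemma IsStationaryProcess.ae_recurrent (hmeas : ∀ n, Measurable (ξ n))
    (hstat : IsStationaryProcess P ξ) :
    ∀ᵐ ω ∂P, ∀ D : ℕ, ∃ M : ℕ, 0 < M ∧ ∀ j < D, ξ ((j + M : ℕ) : ℤ) ω = ξ (j : ℤ) ω := by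
  set μ := P.map fun ω (n : ℤ) => ξ n ω with hμ
  have hpath : Measurable fun ω (n : ℤ) => ξ n ω := measurable_pi_lambda _ hmeas
  have : IsProbabilityMeasure μ := Measure.isProbabilityMeasure_map hpath.aemeasurable
  let σ : (ℤ → ℤ) → (ℤ → ℤ) := fun x n => x (n + 1)
  have hσm : Measurable σ := measurable_pi_lambda _ fun n => measurable_pi_apply _
  have hσ : MeasurePreserving σ μ μ := by
    refine ⟨hσm, ?_⟩
    rw [hμ, Measure.map_map hσm hpath]
    exact (hstat 1).map_eq
  have hiter : ∀ (m : ℕ) (x : ℤ → ℤ) (n : ℤ), σ^[m] x n = x (n + m) := by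
    intro m
    induction m with
    | zero => simp
    | succ m ih =>
      intro x n
      rw [Function.iterate_succ_apply, ih]
      change x (n + m + 1) = _
      push_cast
      rw [add_assoc]
  -- There are only countably many blocks `v` of integers, so recurrence holds for all of them off
  -- one null set.
  have hrec : ∀ᵐ x ∂μ, ∀ (D : ℕ) (v : Fin D → ℤ), (∀ j : Fin D, x (j : ℕ) = v j) →
      ∃ M : ℕ, 0 < M ∧ ∀ j : Fin D, x ((j : ℕ) + M) = v j := by
    refine ae_all_iff.2 fun D => ae_all_iff.2 fun v => ?_
    have hs : MeasurableSet {x : ℤ → ℤ | ∀ j : Fin D, x (j : ℕ) = v j} := by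
      rw [Set.ofPred_forall]
      exact MeasurableSet.iInter fun j =>
        measurableSet_eq_fun (measurable_pi_apply _) measurable_const
    filter_upwards [hσ.conservative.ae_mem_imp_frequently_image_mem hs.nullMeasurableSet] with x hx h
    obtain ⟨M, hM, h⟩ := ((hx h).and_eventually (Filter.eventually_gt_atTop 0)).exists
    exact ⟨M, h, fun j => by exact (hiter M x _).symm.trans (hM j)⟩
  filter_upwards [ae_of_ae_map hpath.aemeasurable hrec] with ω hω D
  obtain ⟨M, hM, h⟩ := hω D (fun j => ξ (j : ℕ) ω) fun _ => rfl
  exact ⟨M, hM, fun j hj => by simpa using h ⟨j, hj⟩⟩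

/-- If the spectral measure lives where `‖q‖ ≤ 1 / 2`, then almost every realization is
eventually annihilated by `(X - 1) * q ^ k` on exponentially long intervals. -/
lemma IsSpectralMeasure.ae_eventually_annihilated {ρ : Measure Circle}
    (hstat : IsStationaryProcess P ξ) (hL2 : MemLp (fun ω => (ξ 0 ω : ℂ)) 2 P)
    (hρ : IsSpectralMeasure P (fun n ω => (ξ n ω : ℂ)) ρ) {q : ℤ[X]}
    (hq : ∀ᵐ t : Circle ∂ρ, ‖aeval (t : ℂ) q‖ ≤ 1 / 2) :
    ∀ᵐ ω ∂P, ∀ᶠ k in Filter.atTop, ∀ n < 2 ^ k,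
      aeval seqShift (((X - 1) * q ^ k : ℤ[X]).map (algebraMap ℤ ℂ))
        (fun m : ℕ => (ξ m ω : ℂ)) n = 0 := by
  have := hρ.isFiniteMeasure
  set Q : ℕ → ℤ[X] := fun k => (X - 1) * q ^ k with hQ
  set A : ℕ → ℕ → Set Ω := fun k n => {ω | ∑ j ∈ Finset.range ((Q k).natDegree + 1),
    (Q k).coeff j * ξ ((n : ℤ) + j) ω ≠ 0} with hA
  set C : ℝ := 4 * ρ.real Set.univ
  have hbound : ∀ k, ∫ t : Circle, ‖aeval (t : ℂ) (Q k)‖ ^ 2 ∂ρ ≤ C * (1 / 4) ^ k := by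
    intro k
    calc _ ≤ ∫ _ : Circle, (4 * (1 / 4) ^ k : ℝ) ∂ρ := by
          refine integral_mono_of_nonneg (Filter.Eventually.of_forall fun t => by positivity)
            (integrable_const _) ?_
          filter_upwards [hq] with t ht
          have h1 : ‖(t : ℂ) - 1‖ ≤ 2 := (norm_sub_le _ _).trans (by
            rw [Circle.norm_coe t, norm_one]; norm_num)
          have e : ‖aeval (t : ℂ) (Q k)‖ = ‖(t : ℂ) - 1‖ * ‖aeval (t : ℂ) q‖ ^ k := by
            simp [hQ]
          calc ‖aeval (t : ℂ) (Q k)‖ ^ 2 ≤ (2 * (1 / 2) ^ k) ^ 2 := by rw [e]; gcongr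
            _ = 4 * (1 / 4) ^ k := by
              rw [mul_pow, ← pow_mul, mul_comm k, pow_mul]; norm_num
      _ = _ := by
          rw [integral_const, smul_eq_mul]; ring
  have hAk : ∀ k n, P.real (A k n) ≤ C * (1 / 4) ^ k := fun k n =>
    (hρ.measureReal_ne_zero_le hstat hL2 (Q k) (by simp [hQ]) n).trans (hbound k)
  -- The window length `2 ^ k` grows, yet `2 ^ k * 4 ^ (-k)` is still summable.
  have hU : ∀ k, P (⋃ n ∈ Finset.range (2 ^ k), A k n) ≤ ENNReal.ofReal (C * (1 / 2) ^ k) := by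
    intro k
    rw [← ofReal_measureReal (measure_ne_top P _)]
    refine ENNReal.ofReal_le_ofReal ((measureReal_biUnion_finset_le _ _).trans ?_)
    calc _ ≤ ∑ n ∈ Finset.range (2 ^ k), C * (1 / 4) ^ k := Finset.sum_le_sum fun n _ => hAk k n
      _ = C * (1 / 2) ^ k := by
        rw [Finset.sum_const, Finset.card_range, nsmul_eq_mul, Nat.cast_pow, Nat.cast_ofNat,
          mul_left_comm, ← mul_pow]
        norm_num
  have hsum : ∑' k, P (⋃ n ∈ Finset.range (2 ^ k), A k n) ≠ ⊤ := by
    refine ne_top_of_le_ne_top ?_ (ENNReal.tsum_le_tsum hU)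
    exact ((summable_geometric_of_lt_one (by norm_num) (by norm_num)).mul_left C).tsum_ofReal_ne_top
  filter_upwards [ae_eventually_notMem hsum] with ω hω
  filter_upwards [hω] with k hk n hn
  simp only [Set.mem_iUnion, not_exists, Finset.mem_range] at hk
  have h := hk n hn
  simp only [hA, Set.mem_ofPred_eq, not_not] at h
  rw [aeval_seqShift_intCast (Q k) (fun m : ℕ => ξ m ω) n]
  simp only [Nat.cast_add, h, Int.cast_zero]

end Periodicity

theorem theorem4p3 {Ω : Type*} [MeasurableSpace Ω] (P : Measure Ω) [IsProbabilityMeasure P]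
    (ξ : ℤ → Ω → ℤ) (hmeas : ∀ n, Measurable (ξ n)) (hstat : IsStationaryProcess P ξ)
    (hL2 : MemLp (fun ω => (ξ 0 ω : ℂ)) 2 P)
    (ρ : Measure Circle) (hρ : IsSpectralMeasure P (fun n ω => (ξ n ω : ℂ)) ρ)
    (hspt : ρ.support ≠ Set.univ) :
    IsPeriodicProcess P ξ := by
  obtain ⟨w, hw, δ, hδ, hgap⟩ := hρ.exists_gap hspt
  obtain ⟨q, hq0, hq⟩ := exists_int_polynomial_norm_le_half hw hδ
  have hinj : Function.Injective (algebraMap ℤ ℂ) := (algebraMap ℤ ℂ).injective_int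
  have hX : (Polynomial.X - 1 : Polynomial ℂ) ≠ 0 := Polynomial.X_sub_C_ne_zero 1
  have hqC : q.map (algebraMap ℤ ℂ) ≠ 0 := (Polynomial.map_ne_zero_iff hinj).2 hq0
  obtain ⟨N, hN, hper⟩ := exists_period_of_recurrent hX hqC
  have hzero : ∀ᵐ ω ∂P, ξ N ω = ξ 0 ω := by
    filter_upwards [hstat.ae_recurrent hmeas, hρ.ae_eventually_annihilated hstat hL2
      (q := q) (hgap.mono fun t ht => hq t (Circle.norm_coe t) ht.1 ht.2)] with ω hrec hann
    have h := hper (fun m : ℕ => (ξ m ω : ℂ))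
      (aeval_seqShift_eq_zero_of_eventually hqC (by simpa using hann))
      (fun D => (hrec D).imp fun M hM => ⟨hM.1, fun j hj => by exact_mod_cast hM.2 j hj⟩) 0
    simpa using h
  -- The one-sided argument is needed only at time `0`; stationarity moves it to every `n`, negative
  -- ones included.
  refine ⟨N, hN, ae_all_iff.2 fun n => ?_⟩
  have h := ((hstat.comp_shift n (u := fun x => (x N, x 0)) (by fun_prop)).symm).ae_snd
    (p := fun y => y.1 = y.2) (measurableSet_eq_fun measurable_fst measurable_snd) hzero
  filter_upwards [h] with ω hω
  simpa [add_comm] using hω
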